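/- Let $I(x) = -x\log x-(1-x)\log(1-x)$ and, for $m>0$ and $\alpha\in(0,1)$, let $f_m(\alpha) = I(\alpha)-\frac{m^2}{2\alpha^2(1-\alpha^2)}$. Let $m^\star$ be the infimum of the $m>0$ for which $f_m$ has no zeros in $(0,1)$. Then $m^\star\approx 0.562$, and $f_{m^\star}$ has exactly one zero $\alpha^\star$ in $(0,1)$, with $\alpha^\star\approx 0.644$ (both values are correct to the three decimals shown: $|m^\star-0.562|\le 0.0005$ and $|\alpha^\star-0.644|\le 0.0005$). Let $\mu$ be a probability law on $\mathbb R$ with mean $0$ and variance $1$ which is strictly subgaussian, i.e. $\int e^{sx}\,d\mu(x)\le e^{s^2/2}$ for all $s\in\mathbb R$. Then there are a constant $C>0$ and an $N_0$ such that the following holds for every $N\ge N_0$. Let $(J_{i,j})_{1\le i,j\le N}$ be independent random variables with law $\mu$, and for $\eta\in\{0,1\}^N$ let $$H(J,\eta)=\frac1{\sqrt N}\sum_{i,j=1}^N J_{i,j}\,\eta_i\eta_j .$$ For $m\in\mathbb R$ let $\nu^-(m)=|\{\eta\in\{0,1\}^N: H(J,\eta)\le -mN\}|$ and $\nu^+(m)=|\{\eta\in\{0,1\}^N: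 H(J,\eta)\ge mN\}|$. Then $$\mathbb P\big(\nu^-(m^\star)>0\big)\le e^{-CN}\qquad\text{and}\qquad \mathbb P\big(\nu^+(m^\star)>0\big)\le e^{-CN}.$$ -/

import Mathlib

open MeasureTheory ProbabilityTheory

namespace Qubo

/-- A particle configuration `η ∈ {0, 1}^N`. -/
abbrev Config (N : ℕ) : Type := Fin N → Fin 2

/-- The Hamiltonian `H(J, η) = N^(-1/2) ∑_{i,j} J i j * η i * η j`. The normalizing constant
is the one for which `∑_{i,j} J i j` (independent couplings of variance `1`), multiplied by it,
has variance `N`. -/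
noncomputable def energy {N : ℕ} (J : Fin N → Fin N → ℝ) (η : Config N) : ℝ :=
  (1 / Real.sqrt N) * ∑ i, ∑ j, J i j * ((η i : ℕ) : ℝ) * ((η j : ℕ) : ℝ)

/-- `ν⁻(m)`: the number of configurations with energy at most `-m N`. -/
noncomputable def nuMinus {N : ℕ} (J : Fin N → Fin N → ℝ) (m : ℝ) : ℕ :=
  (Finset.univ.filter fun η : Config N => energy J η ≤ -m * N).card

/-- `ν⁺(m)`: the number of configurations with energy at least `m N`. -/
noncomputable def nuPlus {N : ℕ} (J : Fin N → Fin N → ℝ) (m : ℝ) : ℕ :=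
  (Finset.univ.filter fun η : Config N => m * N ≤ energy J η).card

/-- The function `α ↦ I(α) - m² / (2 α² (1 - α²))`, where
`I(x) = - x log x - (1 - x) log (1 - x)` is `Real.binEntropy`. It is only used on `(0, 1)`. -/
noncomputable def rate (m α : ℝ) : ℝ :=
  Real.binEntropy α - m ^ 2 / (2 * α ^ 2 * (1 - α ^ 2))

/-- The positive `m` for which `rate m` has no zeros in `(0, 1)`. -/
def zeroFree : Set ℝ := {m | 0 < m ∧ ∀ α ∈ Set.Ioo (0 : ℝ) 1, rate m α ≠ 0}

end Qubo

/-! The zeros of `rate m` are the solutions of `criticalSq α = m ^ 2`, so the critical `m` is the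
square root of the maximum of `criticalSq`. The maximizer is unique because the logarithmic
derivative is positive on (0, 1/2] and strictly decreasing on [1/2, 1); its sign change is located
numerically (`exists_critical`).

For the probability bound, the factor 1 - α² comes from centring: for |S| = αN, subtracting α² times
the total energy lowers the variance proxy from α²N to α²(1 - α²)N, and the total energy exceeds δN
only with exponentially small probability. Since `rate` is nonpositive at the critical level, the
resulting first-moment bound there is only N + 1, with no exponential decay
(`measureReal_centred_ge_le`, `sum_binomial_weight_le`).

The missing decay comes from clustering. Outside exponentially rare events, one configuration at
level mN forces at least exp(48δN - 48) configurations at level (m - 13δ)N, obtained by flipping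
about δN coordinates (`exists_many_flips`, `exp_le_choose`). Lowering the level by 14δ (the extra δ
pays for centring) raises the first-moment bound by at most exp(40δN), so Markov's inequality for
the count gains exp(-8δN). This works because the entropy of choosing the flips is of order δ
log(1/δ), while the cost is linear in δ; δ = exp(-50) is small enough. -/

namespace Qubo

/-! ### The critical pair: calculus and numerics -/

/-- The square of the parameter `m` at which `rate m` vanishes at `α`. -/
noncomputable def criticalSq (α : ℝ) : ℝ := 2 * α ^ 2 * (1 - α ^ 2) * Real.binEntropy α

/-- The logarithmic derivative of `criticalSq`. -/
noncomputable def logSlope (α : ℝ) : ℝ :=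
  2 / α - 2 * α / (1 - α ^ 2) + (Real.log (1 - α) - Real.log α) / Real.binEntropy α

lemma weight_pos {α : ℝ} (hα : α ∈ Set.Ioo (0 : ℝ) 1) : 0 < 2 * α ^ 2 * (1 - α ^ 2) := by
  obtain ⟨h0, h1⟩ := hα
  have : 0 < 1 - α ^ 2 := by nlinarith
  positivity

lemma criticalSq_pos {α : ℝ} (hα : α ∈ Set.Ioo (0 : ℝ) 1) : 0 < criticalSq α :=
  mul_pos (weight_pos hα) (Real.binEntropy_pos hα.1 hα.2)

lemma rate_eq {m α : ℝ} (hα : α ∈ Set.Ioo (0 : ℝ) 1) :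
    rate m α = (criticalSq α - m ^ 2) / (2 * α ^ 2 * (1 - α ^ 2)) := by
  have h := weight_pos hα
  rw [rate, criticalSq, sub_div, mul_div_cancel_left₀ _ h.ne']

lemma rate_eq_zero_iff {m α : ℝ} (hα : α ∈ Set.Ioo (0 : ℝ) 1) :
    rate m α = 0 ↔ criticalSq α = m ^ 2 := by
  rw [rate_eq hα, div_eq_zero_iff, or_iff_left (weight_pos hα).ne', sub_eq_zero]

lemma continuous_criticalSq : Continuous criticalSq := by
  unfold criticalSq; fun_prop

lemma hasDerivAt_criticalSq {α : ℝ} (hα : α ∈ Set.Ioo (0 : ℝ) 1) :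
    HasDerivAt criticalSq (criticalSq α * logSlope α) α := by
  have hw := weight_pos hα
  have hh := Real.binEntropy_pos hα.1 hα.2
  have h1 : HasDerivAt (fun x : ℝ => 2 * x ^ 2 * (1 - x ^ 2)) (4 * α - 8 * α ^ 3) α := by
    have := ((hasDerivAt_pow 2 α).const_mul 2).mul ((hasDerivAt_pow 2 α).const_sub 1)
    refine this.congr_deriv ?_
    simp; ring
  have h2 := h1.mul (Real.hasDerivAt_binEntropy hα.1.ne' hα.2.ne)
  refine h2.congr_deriv ?_
  have e0 : α ≠ 0 := hα.1.ne'
  have e1 : 1 - α ^ 2 ≠ 0 := by have := hα.1; have := hα.2; nlinarith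
  unfold criticalSq logSlope
  field_simp
  ring

lemma logSlope_pos_of_le_half {α : ℝ} (h0 : 0 < α) (h1 : α ≤ 1 / 2) : 0 < logSlope α := by
  have hh := Real.binEntropy_pos h0 (by linarith)
  have hl : Real.log α ≤ Real.log (1 - α) := Real.log_le_log h0 (by linarith)
  have h3 : 0 ≤ (Real.log (1 - α) - Real.log α) / Real.binEntropy α :=
    div_nonneg (by linarith) hh.le
  have h4 : 2 * α / (1 - α ^ 2) < 2 / α := by
    rw [div_lt_div_iff₀ (by nlinarith) h0]; nlinarith
  unfold logSlope; linarith

/-- Past 1/2 each of the three summands is nonincreasing, the first strictly. In the last, the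
numerator is nonpositive and decreasing while the entropy is positive and decreasing, so the
quotient decreases too. -/
lemma logSlope_lt {a b : ℝ} (ha : 1 / 2 ≤ a) (hab : a < b) (hb : b < 1) :
    logSlope b < logSlope a := by
  have h1 : 2 / b < 2 / a := div_lt_div_of_pos_left (by norm_num) (by linarith) hab
  have h2 : 2 * a / (1 - a ^ 2) ≤ 2 * b / (1 - b ^ 2) := by
    have hb' : 0 < 1 - b ^ 2 := by nlinarith
    apply div_le_div₀ (by linarith) (by linarith) hb' (by nlinarith)
  have hha := Real.binEntropy_pos (p := a) (by linarith) (by linarith)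
  have hhb := Real.binEntropy_pos (p := b) (by linarith) (by linarith)
  have hanti : Real.binEntropy b < Real.binEntropy a :=
    Real.binEntropy_strictAntiOn ⟨by norm_num; linarith, by linarith⟩
      ⟨by norm_num; linarith, by linarith⟩ hab
  have hla : Real.log (1 - a) ≤ Real.log a := Real.log_le_log (by linarith) (by linarith)
  have hlab : Real.log a ≤ Real.log b := Real.log_le_log (by linarith) hab.le
  have hlab' : Real.log (1 - b) ≤ Real.log (1 - a) := Real.log_le_log (by linarith) (by linarith)
  have h3 : (Real.log (1 - b) - Real.log b) / Real.binEntropy b ≤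
      (Real.log (1 - a) - Real.log a) / Real.binEntropy a := by
    rw [div_le_div_iff₀ hhb hha]; nlinarith
  unfold logSlope; linarith

/-- Bounds for `log y`, `0 < y < 1`, from the series of `log ((1 + x) / (1 - x))`. -/
lemma log_bounds {y : ℝ} (h0 : 0 < y) (h1 : y < 1) (n : ℕ) :
    -2 * ((∑ i ∈ Finset.range n, ((1 - y) / (1 + y)) ^ (2 * i + 1) / (2 * i + 1)) +
      ((1 - y) / (1 + y)) ^ (2 * n + 1) / (1 - ((1 - y) / (1 + y)) ^ 2)) ≤ Real.log y ∧
    Real.log y ≤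
      -2 * ∑ i ∈ Finset.range n, ((1 - y) / (1 + y)) ^ (2 * i + 1) / (2 * i + 1) := by
  have hx0 : 0 ≤ (1 - y) / (1 + y) := div_nonneg (by linarith) (by linarith)
  have hx1 : (1 - y) / (1 + y) < 1 := by rw [div_lt_one (by linarith)]; linarith
  have e : (1 + (1 - y) / (1 + y)) / (1 - (1 - y) / (1 + y)) = y⁻¹ := by
    have : 1 + y ≠ 0 := by linarith
    rw [show 1 + (1 - y) / (1 + y) = 2 / (1 + y) by field_simp; ring,
      show 1 - (1 - y) / (1 + y) = 2 * y / (1 + y) by field_simp; ring]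
    field_simp
  have u := Real.log_div_le_sum_range_add hx0 hx1 n
  have l := Real.sum_range_le_log_div hx0 hx1 n
  rw [e, Real.log_inv] at u l
  constructor <;> linarith

lemma log_6435 : -0.440835 ≤ Real.log 0.6435 ∧ Real.log 0.6435 ≤ -0.440832 := by
  have h := log_bounds (y := 0.6435) (by norm_num) (by norm_num) 5
  norm_num [Finset.sum_range_succ] at h ⊢
  constructor <;> linarith [h.1, h.2]

lemma log_3565 : -1.031430 ≤ Real.log 0.3565 ∧ Real.log 0.3565 ≤ -1.031420 := by
  have h := log_bounds (y := 0.3565) (by norm_num) (by norm_num) 9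
  norm_num [Finset.sum_range_succ] at h ⊢
  constructor <;> linarith [h.1, h.2]

lemma log_6445 : -0.439285 ≤ Real.log 0.6445 ∧ Real.log 0.6445 ≤ -0.439280 := by
  have h := log_bounds (y := 0.6445) (by norm_num) (by norm_num) 5
  norm_num [Finset.sum_range_succ] at h ⊢
  constructor <;> linarith [h.1, h.2]

lemma log_3555 : -1.034240 ≤ Real.log 0.3555 ∧ Real.log 0.3555 ≤ -1.034230 := by
  have h := log_bounds (y := 0.3555) (by norm_num) (by norm_num) 11
  norm_num [Finset.sum_range_succ] at h ⊢
  constructor <;> linarith [h.1, h.2]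

lemma binEntropy_eq_logs (p : ℝ) :
    Real.binEntropy p = -(p * Real.log p) - (1 - p) * Real.log (1 - p) := by
  rw [Real.binEntropy, Real.log_inv, Real.log_inv]; ring

lemma binEntropy_6435 :
    0.65137 ≤ Real.binEntropy 0.6435 ∧ Real.binEntropy 0.6435 ≤ 0.65139 := by
  obtain ⟨h1, h2⟩ := log_6435
  obtain ⟨h3, h4⟩ := log_3565
  rw [binEntropy_eq_logs, show (1 : ℝ) - 0.6435 = 0.3565 by norm_num]
  constructor <;> linarith

lemma binEntropy_6445 :
    0.65078 ≤ Real.binEntropy 0.6445 ∧ Real.binEntropy 0.6445 ≤ 0.65080 := by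
  obtain ⟨h1, h2⟩ := log_6445
  obtain ⟨h3, h4⟩ := log_3555
  rw [binEntropy_eq_logs, show (1 : ℝ) - 0.6445 = 0.3555 by norm_num]
  constructor <;> linarith

lemma logSlope_6435_pos : 0 < logSlope 0.6435 := by
  have hb := binEntropy_6435.1
  have h : -0.9068 ≤ (Real.log 0.3565 - Real.log 0.6435) / Real.binEntropy 0.6435 := by
    rw [le_div_iff₀ (by linarith)]; linarith [log_6435.2, log_3565.1]
  rw [logSlope, show (1 : ℝ) - 0.6435 = 0.3565 by norm_num]
  norm_num at h ⊢; linarith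

lemma logSlope_6445_neg : logSlope 0.6445 < 0 := by
  have hb := binEntropy_6445
  have h : (Real.log 0.3555 - Real.log 0.6445) / Real.binEntropy 0.6445 ≤ -0.9140 := by
    rw [div_le_iff₀ (by linarith)]; linarith [log_6445.1, log_3555.2]
  rw [logSlope, show (1 : ℝ) - 0.6445 = 0.3555 by norm_num]
  norm_num at h ⊢; linarith

lemma logSlope_injOn_zero {a b : ℝ} (ha : a ∈ Set.Ioo (0 : ℝ) 1) (hb : b ∈ Set.Ioo (0 : ℝ) 1)
    (hsa : logSlope a = 0) (hsb : logSlope b = 0) : a = b := by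
  have ha' : 1 / 2 ≤ a := by
    by_contra! h; linarith [logSlope_pos_of_le_half ha.1 h.le]
  have hb' : 1 / 2 ≤ b := by
    by_contra! h; linarith [logSlope_pos_of_le_half hb.1 h.le]
  rcases lt_trichotomy a b with h | h | h
  · linarith [logSlope_lt ha' h hb.2]
  · exact h
  · linarith [logSlope_lt hb' h ha.2]

lemma mem_Icc_of_logSlope_eq_zero {a : ℝ} (ha : a ∈ Set.Ioo (0 : ℝ) 1) (hs : logSlope a = 0) :
    a ∈ Set.Icc (0.6435 : ℝ) 0.6445 := by
  have ha' : 1 / 2 ≤ a := by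
    by_contra! h; linarith [logSlope_pos_of_le_half ha.1 h.le]
  constructor
  · by_contra! h
    linarith [logSlope_lt ha' h (by norm_num), logSlope_6435_pos]
  · by_contra! h
    linarith [logSlope_lt (by norm_num) h ha.2, logSlope_6445_neg]

lemma criticalSq_6435 : 0.31530 ≤ criticalSq 0.6435 := by
  unfold criticalSq; linarith [binEntropy_6435.1]

lemma criticalSq_le_of_mem {a : ℝ} (ha : a ∈ Set.Icc (0.6435 : ℝ) 0.6445) :
    criticalSq a ≤ 0.3164 := by
  obtain ⟨h1, h2⟩ := ha
  -- Here a² < 1/2, so the weight increases in a and is bounded by its value at the right endpoint;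
  -- the entropy decreases and is bounded at the left one.
  have hw : 2 * a ^ 2 * (1 - a ^ 2) ≤ 0.48569 := by
    have hs : a ^ 2 ≤ 0.6445 ^ 2 := by gcongr
    nlinarith
  have hh : Real.binEntropy a ≤ 0.65139 := by
    refine le_trans ?_ binEntropy_6435.2
    exact Real.binEntropy_strictAntiOn.antitoneOn ⟨by norm_num, by norm_num⟩
      ⟨by norm_num at *; linarith, by norm_num at *; linarith⟩ h1
  have hw0 := weight_pos (α := a) ⟨by norm_num at *; linarith, by norm_num at *; linarith⟩
  unfold criticalSq
  calc _ ≤ 0.48569 * (0.65139 : ℝ) := by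
        apply mul_le_mul hw hh _ (by norm_num)
        exact Real.binEntropy_nonneg (by norm_num at *; linarith) (by norm_num at *; linarith)
    _ ≤ _ := by norm_num

lemma exists_max_criticalSq :
    ∃ a ∈ Set.Ioo (0 : ℝ) 1, ∀ b ∈ Set.Ioo (0 : ℝ) 1, criticalSq b ≤ criticalSq a := by
  obtain ⟨a, ha, hmax⟩ := isCompact_Icc.exists_isMaxOn (Set.nonempty_Icc.2 zero_le_one)
    (continuous_criticalSq.continuousOn (s := Set.Icc (0 : ℝ) 1))
  have hpos : 0 < criticalSq a :=
    (criticalSq_pos (α := 1 / 2) ⟨by norm_num, by norm_num⟩).trans_le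
      (hmax ⟨by norm_num, by norm_num⟩)
  refine ⟨a, ⟨lt_of_le_of_ne ha.1 ?_, lt_of_le_of_ne ha.2 ?_⟩, fun b hb => hmax ⟨hb.1.le, hb.2.le⟩⟩
  · rintro rfl; simp [criticalSq] at hpos
  · rintro rfl; simp [criticalSq] at hpos

lemma logSlope_eq_zero_of_max {a : ℝ} (ha : a ∈ Set.Ioo (0 : ℝ) 1)
    (hmax : ∀ b ∈ Set.Ioo (0 : ℝ) 1, criticalSq b ≤ criticalSq a) : logSlope a = 0 := by
  have hloc : IsLocalMax criticalSq a := by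
    filter_upwards [Ioo_mem_nhds ha.1 ha.2] with b hb using hmax b hb
  have := hloc.hasDerivAt_eq_zero (hasDerivAt_criticalSq ha)
  exact (mul_eq_zero.1 this).resolve_left (criticalSq_pos ha).ne'

lemma isGLB_zeroFree {a : ℝ} (ha : a ∈ Set.Ioo (0 : ℝ) 1)
    (hmax : ∀ b ∈ Set.Ioo (0 : ℝ) 1, criticalSq b ≤ criticalSq a) :
    IsGLB zeroFree (Real.sqrt (criticalSq a)) := by
  have hpos := criticalSq_pos ha
  constructor
  · rintro m ⟨hm, hz⟩
    by_contra! hlt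
    have hm2 : m ^ 2 < criticalSq a := (Real.lt_sqrt hm.le).1 hlt
    -- `criticalSq` rises continuously from 0 at 0 to its maximum at a, so every smaller positive m²
    -- is attained and gives a zero.
    have hivt := intermediate_value_Ioo ha.1.le (continuous_criticalSq.continuousOn)
    have hc0 : criticalSq 0 = 0 := by simp [criticalSq]
    rw [hc0] at hivt
    obtain ⟨b, hb, hb2⟩ := hivt ⟨by positivity, hm2⟩
    have hb' : b ∈ Set.Ioo (0 : ℝ) 1 := ⟨hb.1, hb.2.trans ha.2⟩
    exact hz b hb' ((rate_eq_zero_iff hb').2 hb2)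
  · intro l hl
    refine le_of_forall_gt_imp_ge_of_dense fun m hm => hl ⟨?_, fun b hb hz => ?_⟩
    · exact (Real.sqrt_nonneg _).trans_lt hm
    · rw [rate_eq_zero_iff hb] at hz
      have := (Real.sqrt_lt' ((Real.sqrt_nonneg _).trans_lt hm)).1 hm
      linarith [hmax b hb]

/-- The critical pair: `m = √(max criticalSq)` and the maximizer. -/
theorem exists_critical :
    ∃ m a : ℝ, IsGLB zeroFree m ∧ a ∈ Set.Ioo (0 : ℝ) 1 ∧ rate m a = 0 ∧
      (∀ b ∈ Set.Ioo (0 : ℝ) 1, rate m b = 0 → b = a) ∧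
      |m - 0.562| ≤ 0.0005 ∧ |a - 0.644| ≤ 0.0005 ∧
      ∀ b ∈ Set.Ioo (0 : ℝ) 1, criticalSq b ≤ m ^ 2 := by
  obtain ⟨a, ha, hmax⟩ := exists_max_criticalSq
  have hpos := criticalSq_pos ha
  have hsq : Real.sqrt (criticalSq a) ^ 2 = criticalSq a := Real.sq_sqrt hpos.le
  have hs := logSlope_eq_zero_of_max ha hmax
  have hI := mem_Icc_of_logSlope_eq_zero ha hs
  have hup := criticalSq_le_of_mem hI
  have hlow := criticalSq_6435.trans (hmax 0.6435 ⟨by norm_num, by norm_num⟩)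
  refine ⟨Real.sqrt (criticalSq a), a, isGLB_zeroFree ha hmax, ha, ?_, ?_, ?_, ?_, ?_⟩
  · rw [rate_eq_zero_iff ha, hsq]
  · intro b hb hz
    rw [rate_eq_zero_iff hb, hsq] at hz
    exact logSlope_injOn_zero hb ha
      (logSlope_eq_zero_of_max hb fun c hc => (hmax c hc).trans hz.ge) hs
  · rw [abs_le]
    constructor
    · have : (0.5615 : ℝ) ≤ Real.sqrt (criticalSq a) :=
        Real.le_sqrt_of_sq_le (by norm_num at *; linarith)
      norm_num at *; linarith
    · have : Real.sqrt (criticalSq a) ≤ 0.5625 :=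
        Real.sqrt_le_iff.2 ⟨by norm_num, by norm_num at *; linarith⟩
      norm_num at *; linarith
  · rw [abs_le]
    obtain ⟨h1, h2⟩ := hI
    constructor <;> norm_num at * <;> linarith
  · intro b hb
    rw [hsq]; exact hmax b hb

/-! ### Chernoff and Markov bounds -/

/-- Chernoff bound for linear combinations of independent `1`-subgaussian variables. -/
lemma measureReal_linear_ge_le {ι Ω : Type*} [Fintype ι] [MeasurableSpace Ω] {P : Measure Ω}
    [IsProbabilityMeasure P] {X : ι → Ω → ℝ} (hX : ∀ p, HasSubgaussianMGF (X p) 1 P)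
    (hind : iIndepFun X P) (a : ι → ℝ) {c t : ℝ} (hc : ∑ p, a p ^ 2 ≤ c) (ht : 0 ≤ t) :
    P.real {ω | t ≤ ∑ p, a p * X p ω} ≤ Real.exp (-t ^ 2 / (2 * c)) := by
  have hc0 : 0 ≤ c := (Finset.sum_nonneg fun p _ => sq_nonneg (a p)).trans hc
  have hY : ∀ p, HasSubgaussianMGF (fun ω => a p * X p ω) (⟨a p ^ 2, sq_nonneg _⟩ * 1) P :=
    fun p => (hX p).const_mul (a p)
  have hindY : iIndepFun (fun p ω => a p * X p ω) P :=
    hind.comp (fun p x => a p * x) (fun p => measurable_const_mul _)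
  have hsum := HasSubgaussianMGF.sum_of_iIndepFun hindY (s := Finset.univ) fun p _ => hY p
  have hmono : HasSubgaussianMGF (fun ω => ∑ p, a p * X p ω) ⟨c, hc0⟩ P := by
    refine ⟨hsum.integrable_exp_mul, fun t => (hsum.mgf_le t).trans ?_⟩
    apply Real.exp_le_exp.2
    have : ((∑ p, (⟨a p ^ 2, sq_nonneg _⟩ * 1 : NNReal) : NNReal) : ℝ) = ∑ p, a p ^ 2 := by
      rw [NNReal.coe_sum]
      refine Finset.sum_congr rfl fun p _ => ?_
      exact mul_one (a p ^ 2)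
    rw [this]
    change _ ≤ c * t ^ 2 / 2
    gcongr
  exact hmono.measure_ge_le ht

/-- Markov's inequality for the number of events of a finite family that occur. -/
lemma mul_measureReal_le_sum {ι Ω : Type*} [Fintype ι] [MeasurableSpace Ω] {P : Measure Ω}
    [IsProbabilityMeasure P] (A : Set Ω) (B : ι → Set Ω) (M : ℕ)
    (h : ∀ ω ∈ A, ∃ s : Finset ι, M ≤ s.card ∧ ∀ i ∈ s, ω ∈ B i) :
    M * P.real A ≤ ∑ i, P.real (B i) := by
  classical
  -- The events need not be measurable; measurable hulls have the same measure and make the count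
  -- measurable.
  let f : Ω → ENNReal := fun ω => ∑ i, (toMeasurable P (B i)).indicator 1 ω
  have hf : Measurable f := by
    refine Finset.measurable_sum _ fun i _ => ?_
    exact measurable_one.indicator (measurableSet_toMeasurable _ _)
  have hsub : A ⊆ {ω | (M : ENNReal) ≤ f ω} := by
    intro ω hω
    obtain ⟨s, hs, hB⟩ := h ω hω
    calc (M : ENNReal) ≤ s.card := by exact_mod_cast hs
      _ = ∑ i ∈ s, (toMeasurable P (B i)).indicator (1 : Ω → ENNReal) ω := by
        rw [Finset.sum_congr rfl (g := fun _ => (1 : ENNReal))]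
        · simp
        · intro i hi
          rw [Set.indicator_of_mem (subset_toMeasurable P _ (hB i hi))]; rfl
      _ ≤ f ω := Finset.sum_le_sum_of_subset (Finset.subset_univ s)
  have hE : (M : ENNReal) * P A ≤ ∑ i, P (B i) := by
    calc (M : ENNReal) * P A ≤ M * P {ω | (M : ENNReal) ≤ f ω} := by gcongr
      _ ≤ ∫⁻ ω, f ω ∂P := mul_meas_ge_le_lintegral hf _
      _ = ∑ i, P (B i) := by
        rw [lintegral_finsetSum _ fun i _ =>
          measurable_one.indicator (measurableSet_toMeasurable _ _)]
        refine Finset.sum_congr rfl fun i _ => ?_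
        rw [lintegral_indicator_one (measurableSet_toMeasurable _ _), measure_toMeasurable]
  have := ENNReal.toReal_mono (by simp [ENNReal.sum_eq_top]) hE
  rwa [ENNReal.toReal_mul, ENNReal.toReal_sum (by simp), ENNReal.toReal_natCast] at this

/-! ### Flipping coordinates: the deterministic argument -/

/-- The bilinear form with matrix `J`. -/
def quad {N : ℕ} (J : Fin N → Fin N → ℝ) (x y : Fin N → ℝ) : ℝ := ∑ i, ∑ j, J i j * x i * y j

/-- The indicator vector of `S`. -/
def ind {N : ℕ} (S : Finset (Fin N)) (i : Fin N) : ℝ := if i ∈ S then 1 else 0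

/-- The change of the indicator vector of `S` when the coordinates in `D` are flipped. -/
def flip {N : ℕ} (S D : Finset (Fin N)) (i : Fin N) : ℝ :=
  if i ∈ D then (if i ∈ S then -1 else 1) else 0

section Deterministic

variable {N : ℕ} (J : Fin N → Fin N → ℝ)

lemma ind_symmDiff (S D : Finset (Fin N)) : ind (symmDiff S D) = fun i => ind S i + flip S D i := by
  ext i
  by_cases h1 : i ∈ S <;> by_cases h2 : i ∈ D <;> simp [ind, flip, Finset.mem_symmDiff, h1, h2]

lemma quad_add_add (x y : Fin N → ℝ) :
    quad J (fun i => x i + y i) (fun i => x i + y i) =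
      quad J x x + (quad J y x + quad J x y) + quad J y y := by
  simp only [quad, ← Finset.sum_add_distrib]
  refine Finset.sum_congr rfl fun i _ => Finset.sum_congr rfl fun j _ => ?_
  ring

lemma quad_flip_add (S D : Finset (Fin N)) :
    quad J (flip S D) (ind S) + quad J (ind S) (flip S D) =
      ∑ i ∈ D, (if i ∈ S then -1 else 1) * ∑ j, (J i j + J j i) * ind S j := by
  have h2 : quad J (ind S) (flip S D) = ∑ i, ∑ j, J j i * ind S j * flip S D i := by
    rw [quad, Finset.sum_comm]
  rw [h2, quad, ← Finset.sum_add_distrib, ← Finset.sum_subset (Finset.subset_univ D)]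
  · refine Finset.sum_congr rfl fun i hi => ?_
    rw [← Finset.sum_add_distrib, Finset.mul_sum]
    refine Finset.sum_congr rfl fun j _ => ?_
    simp only [flip, hi, if_true]; ring
  · intro i _ hi
    simp [flip, hi]

/-- If no large set of flips is costly to first order, and no set of `n` flips is costly to second
order, then a configuration of high energy has many neighbours of high energy. -/
lemma exists_many_flips {n : ℕ} {s E : ℝ} (hs : 0 ≤ s)
    (h1 : ∀ S B : Finset (Fin N), N ≤ 2 * B.card →
      -(5 * N * s) < quad J (flip S B) (ind S) + quad J (ind S) (flip S B))
    (h2 : ∀ S D : Finset (Fin N), D.card = n → -(3 * n * s) < quad J (flip S D) (flip S D))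
    {S : Finset (Fin N)} (hS : E ≤ quad J (ind S) (ind S)) :
    ∃ F : Finset (Finset (Fin N)), ((N + 1) / 2).choose n ≤ F.card ∧
      ∀ S' ∈ F, E - 13 * n * s ≤ quad J (ind S') (ind S') := by
  classical
  -- The first-order change when i is flipped. If half of the coordinates had f < -10s, flipping
  -- them all would violate `h1`. Flipping n of the others costs at most 10ns to first order and 3ns
  -- to second order.
  let f : Fin N → ℝ := fun i => (if i ∈ S then -1 else 1) * ∑ j, (J i j + J j i) * ind S j
  let B : Finset (Fin N) := Finset.univ.filter fun i => f i < -(10 * s)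
  have hB : 2 * B.card < N := by
    by_contra! hN
    have h := h1 S B hN
    rw [quad_flip_add] at h
    have hle : ∑ i ∈ B, f i ≤ ∑ _i ∈ B, -(10 * s) :=
      Finset.sum_le_sum fun i hi => (Finset.mem_filter.1 hi).2.le
    rw [Finset.sum_const, nsmul_eq_mul] at hle
    have hN' : (N : ℝ) ≤ 2 * B.card := by exact_mod_cast hN
    have : (N : ℝ) * s ≤ 2 * B.card * s := by gcongr
    have h' : -(5 * N * s) < ∑ i ∈ B, f i := h
    nlinarith
  have hT : (N + 1) / 2 ≤ Bᶜ.card := by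
    rw [Finset.card_compl, Fintype.card_fin]; omega
  refine ⟨(Finset.powersetCard n Bᶜ).image fun D => symmDiff S D, ?_, ?_⟩
  · rw [Finset.card_image_of_injective _ (symmDiff_right_injective S), Finset.card_powersetCard]
    exact Nat.choose_le_choose n hT
  · intro S' hS'
    obtain ⟨D, hD, rfl⟩ := Finset.mem_image.1 hS'
    obtain ⟨hDT, hDn⟩ := Finset.mem_powersetCard.1 hD
    rw [ind_symmDiff, quad_add_add, quad_flip_add]
    have hlow : ∑ _i ∈ D, -(10 * s) ≤ ∑ i ∈ D, f i := by
      refine Finset.sum_le_sum fun i hi => ?_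
      have := hDT hi
      simpa [B] using this
    rw [Finset.sum_const, nsmul_eq_mul, hDn] at hlow
    have h := h2 S D hDn
    have hlow' : (n : ℝ) * -(10 * s) ≤
      ∑ i ∈ D, (if i ∈ S then -1 else 1) * ∑ j, (J i j + J j i) * ind S j := hlow
    nlinarith

end Deterministic

/-! ### Binomial weights and entropy -/

section Entropy

/-- The largest point mass of a binomial law is at most one. -/
lemma choose_mul_pow_le_one {N k : ℕ} (hk : k ≤ N) {p : ℝ} (h0 : 0 ≤ p) (h1 : p ≤ 1) :
    (N.choose k : ℝ) * (p ^ k * (1 - p) ^ (N - k)) ≤ 1 := by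
  have h := add_pow p (1 - p) N
  rw [add_sub_cancel, one_pow] at h
  have hs := Finset.single_le_sum (f := fun m => p ^ m * (1 - p) ^ (N - m) * (N.choose m : ℝ))
    (fun m _ => mul_nonneg (mul_nonneg (pow_nonneg h0 _) (pow_nonneg (by linarith) _))
      (Nat.cast_nonneg _)) (Finset.mem_range_succ_iff.2 hk)
  exact (mul_comm _ _).trans_le (hs.trans h.ge)

lemma exp_neg_binEntropy {N k : ℕ} (hk0 : 0 < k) (hkN : k < N) :
    Real.exp (-(N * Real.binEntropy (k / N))) =
      ((k : ℝ) / N) ^ k * (1 - (k : ℝ) / N) ^ (N - k) := by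
  have hN : (0 : ℝ) < N := by exact_mod_cast hk0.trans hkN
  have hk : (0 : ℝ) < k := by exact_mod_cast hk0
  have hk' : (k : ℝ) < N := by exact_mod_cast hkN
  have hp : 0 < (k : ℝ) / N := by positivity
  have hp1 : 0 < 1 - (k : ℝ) / N := by rw [sub_pos, div_lt_one hN]; exact hk'
  rw [← Real.exp_log (mul_pos (pow_pos hp k) (pow_pos hp1 _)), Real.log_mul (by positivity)
    (by positivity), Real.log_pow, Real.log_pow, Nat.cast_sub hkN.le, binEntropy_eq_logs]
  congr 1
  field_simp
  ring

/-- Grouped by k = |S|, the terms are the point masses at k of Binomial(N, k/N), each at most 1, and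
k takes N + 1 values. This is a union bound with entropy weights. -/
lemma sum_binomial_weight_le (N : ℕ) :
    ∑ S : Finset (Fin N),
      ((S.card : ℝ) / N) ^ S.card * (1 - (S.card : ℝ) / N) ^ (N - S.card) ≤ N + 1 := by
  have h := Finset.sum_powerset_apply_card
    (fun k => ((k : ℝ) / N) ^ k * (1 - (k : ℝ) / N) ^ (N - k)) (x := (Finset.univ : Finset (Fin N)))
  rw [Finset.powerset_univ, Finset.card_univ, Fintype.card_fin] at h
  rw [h]
  calc _ ≤ ∑ _m ∈ Finset.range (N + 1), (1 : ℝ) := by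
        refine Finset.sum_le_sum fun k hk => ?_
        rw [nsmul_eq_mul]
        have hk' := Finset.mem_range_succ_iff.1 hk
        refine choose_mul_pow_le_one hk' (by positivity) ?_
        exact div_le_one_of_le₀ (by exact_mod_cast hk') (by positivity)
    _ = N + 1 := by simp

/-- Combines (a + 1 - n)^n / n! ≤ C(a, n) with n! ≤ n^n. -/
lemma pow_le_choose_of_mul_le {a n : ℕ} {r : ℝ} (hr : 0 ≤ r) (hna : n ≤ a + 1)
    (h : r * n ≤ a + 1 - n) : r ^ n ≤ (a.choose n : ℝ) := by
  refine le_trans ?_ (Nat.pow_le_choose (α := ℝ) n a)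
  rw [le_div_iff₀ (by positivity)]
  calc r ^ n * (n.factorial : ℝ) ≤ r ^ n * (n : ℝ) ^ n := by
        gcongr; exact_mod_cast Nat.factorial_le_pow n
    _ = (r * n) ^ n := by rw [mul_pow]
    _ ≤ ((a + 1 - n : ℕ) : ℝ) ^ n := by
        rw [Nat.cast_sub hna]; push_cast
        gcongr

end Entropy

/-! ### Probability estimates -/

section Probability

variable {N : ℕ} {Ω : Type*}

lemma quad_eq_sum (X : Fin N × Fin N → Ω → ℝ) (ω : Ω) (x y : Fin N → ℝ) :
    quad (fun i j => X (i, j) ω) x y = ∑ p : Fin N × Fin N, x p.1 * y p.2 * X p ω := by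
  rw [quad, Fintype.sum_prod_type]
  refine Finset.sum_congr rfl fun i _ => Finset.sum_congr rfl fun j _ => ?_
  ring

lemma abs_ind_le_one (S : Finset (Fin N)) (i : Fin N) : |ind S i| ≤ 1 := by
  unfold ind; split_ifs <;> simp

lemma abs_flip_le_one (S D : Finset (Fin N)) (i : Fin N) : |flip S D i| ≤ 1 := by
  unfold flip; split_ifs <;> simp

lemma sum_ind (S : Finset (Fin N)) : ∑ i, ind S i = S.card := by
  simp [ind]

lemma ind_sq (S : Finset (Fin N)) (i : Fin N) : ind S i ^ 2 = ind S i := by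
  unfold ind; split_ifs <;> simp

lemma sum_flip_sq (S D : Finset (Fin N)) : ∑ i, flip S D i ^ 2 = D.card := by
  have : ∀ i, flip S D i ^ 2 = if i ∈ D then 1 else 0 := by
    intro i; unfold flip; split_ifs <;> simp
  simp [this]

lemma sum_prod_mul (x y : Fin N → ℝ) :
    ∑ p : Fin N × Fin N, x p.1 * y p.2 = (∑ i, x i) * ∑ j, y j := by
  rw [Fintype.sum_prod_type, Finset.sum_mul_sum]

variable [MeasurableSpace Ω] {P : Measure Ω} {X : Fin N × Fin N → Ω → ℝ}

/-- There are 4^N ≤ e^{2N} pairs, so a rate of 3N survives the union bound with N to spare. -/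
lemma measureReal_exists_pair_le (A : Finset (Fin N) → Finset (Fin N) → Set Ω)
    (h : ∀ S B, P.real (A S B) ≤ Real.exp (-(3 * N))) :
    P.real {ω | ∃ S B, ω ∈ A S B} ≤ Real.exp (-N) := by
  have e : {ω | ∃ S B, ω ∈ A S B} = ⋃ p : Finset (Fin N) × Finset (Fin N), A p.1 p.2 := by
    ext ω; simp
  rw [e]
  refine (measureReal_iUnion_fintype_le _).trans ?_
  refine (Finset.sum_le_sum fun p _ => h p.1 p.2).trans ?_
  rw [Finset.sum_const, Finset.card_univ, Fintype.card_prod, Fintype.card_finset,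
    Fintype.card_fin, nsmul_eq_mul]
  push_cast
  have h2 : (2 : ℝ) ^ N ≤ Real.exp N := by
    rw [← Real.exp_one_pow]
    gcongr
    linarith [Real.add_one_le_exp (1 : ℝ)]
  calc (2 : ℝ) ^ N * 2 ^ N * Real.exp (-(3 * N)) ≤
      Real.exp N * Real.exp N * Real.exp (-(3 * N)) := by gcongr
    _ = Real.exp (-N) := by rw [← Real.exp_add, ← Real.exp_add]; ring_nf

variable [IsProbabilityMeasure P]

lemma measureReal_flip_linear_le (hN : 0 < N) (hX : ∀ p, HasSubgaussianMGF (X p) 1 P)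
    (hind : iIndepFun X P) :
    P.real {ω | ∃ S B : Finset (Fin N), quad (fun i j => X (i, j) ω) (flip S B) (ind S) +
      quad (fun i j => X (i, j) ω) (ind S) (flip S B) ≤ -(5 * N * √N)} ≤ Real.exp (-N) := by
  refine measureReal_exists_pair_le (fun S B => {ω | quad (fun i j => X (i, j) ω) (flip S B) (ind S)
    + quad (fun i j => X (i, j) ω) (ind S) (flip S B) ≤ -(5 * N * √N)}) fun S B => ?_
  have hN' : (0 : ℝ) < N := by exact_mod_cast hN
  have hs : √(N : ℝ) ^ 2 = N := Real.sq_sqrt hN'.le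
  -- Each coefficient is at most 2 in absolute value, hence c = 4N²; the exponent is then 25N/8 ≥
  -- 3N.
  have h := measureReal_linear_ge_le hX hind
    (fun p => -(flip S B p.1 * ind S p.2 + ind S p.1 * flip S B p.2)) (c := 4 * N ^ 2)
    (t := 5 * N * √N) ?_ (by positivity)
  · refine le_trans (measureReal_mono ?_) (h.trans ?_)
    · intro ω hω
      simp only [Set.mem_ofPred_eq, quad_eq_sum, ← Finset.sum_add_distrib] at hω ⊢
      rw [← neg_le_neg_iff, ← Finset.sum_neg_distrib]
      refine le_trans (le_of_eq ?_) hω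
      refine Finset.sum_congr rfl fun p _ => ?_
      ring
    · apply Real.exp_le_exp.2
      rw [div_le_iff₀ (by positivity), mul_pow, hs]
      nlinarith [pow_pos hN' 3]
  · calc _ ≤ ∑ _p : Fin N × Fin N, (4 : ℝ) := by
          refine Finset.sum_le_sum fun p _ => ?_
          rw [neg_sq, ← sq_abs]
          have h1 : |flip S B p.1 * ind S p.2| ≤ 1 := by
            rw [abs_mul]
            exact mul_le_one₀ (abs_flip_le_one _ _ _) (abs_nonneg _) (abs_ind_le_one _ _)
          have h2 : |ind S p.1 * flip S B p.2| ≤ 1 := by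
            rw [abs_mul]
            exact mul_le_one₀ (abs_ind_le_one _ _) (abs_nonneg _) (abs_flip_le_one _ _ _)
          have h3 := (abs_add_le (flip S B p.1 * ind S p.2) (ind S p.1 * flip S B p.2))
          have h4 := abs_nonneg (flip S B p.1 * ind S p.2 + ind S p.1 * flip S B p.2)
          nlinarith
      _ = 4 * N ^ 2 := by simp; ring

lemma measureReal_flip_quadratic_le (hN : 0 < N) (hX : ∀ p, HasSubgaussianMGF (X p) 1 P)
    (hind : iIndepFun X P) {n : ℕ} (hn : 0 < n) :
    P.real {ω | ∃ S D : Finset (Fin N), D.card = n ∧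
      quad (fun i j => X (i, j) ω) (flip S D) (flip S D) ≤ -(3 * n * √N)} ≤ Real.exp (-N) := by
  refine measureReal_exists_pair_le (fun S D => {ω | D.card = n ∧
    quad (fun i j => X (i, j) ω) (flip S D) (flip S D) ≤ -(3 * n * √N)}) fun S D => ?_
  by_cases hD : D.card = n
  swap
  · simp [hD, Real.exp_nonneg]
  have hN' : (0 : ℝ) < N := by exact_mod_cast hN
  have hn' : (0 : ℝ) < n := by exact_mod_cast hn
  have hs : √(N : ℝ) ^ 2 = N := Real.sq_sqrt hN'.le
  -- The squared coefficients sum to exactly n², giving the exponent 9N/2 ≥ 3N.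
  have h := measureReal_linear_ge_le hX hind
    (fun p => -(flip S D p.1 * flip S D p.2)) (c := n ^ 2)
    (t := 3 * n * √N) ?_ (by positivity)
  · refine le_trans (measureReal_mono ?_) (h.trans ?_)
    · rintro ω ⟨-, hω⟩
      simp only [Set.mem_ofPred_eq, quad_eq_sum] at hω ⊢
      rw [← neg_le_neg_iff, ← Finset.sum_neg_distrib]
      refine le_trans (le_of_eq ?_) hω
      refine Finset.sum_congr rfl fun p _ => ?_
      ring
    · apply Real.exp_le_exp.2
      rw [div_le_iff₀ (by positivity), mul_pow, hs]
      nlinarith [mul_pos (pow_pos hn' 2) hN']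
  · apply le_of_eq
    simp only [neg_sq, mul_pow]
    rw [sum_prod_mul (fun i => flip S D i ^ 2) (fun i => flip S D i ^ 2), sum_flip_sq, hD]
    ring

lemma measureReal_total_ge_le (hN : 0 < N) (hX : ∀ p, HasSubgaussianMGF (X p) 1 P)
    (hind : iIndepFun X P) {δ : ℝ} (hδ : 0 ≤ δ) :
    P.real {ω | δ * N * √N ≤ quad (fun i j => X (i, j) ω) (ind Finset.univ) (ind Finset.univ)} ≤
      Real.exp (-(δ ^ 2 * N / 2)) := by
  have hN' : (0 : ℝ) < N := by exact_mod_cast hN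
  have hs : √(N : ℝ) ^ 2 = N := Real.sq_sqrt hN'.le
  have hc : ∑ p : Fin N × Fin N, (ind Finset.univ p.1 * ind Finset.univ p.2) ^ 2 ≤ (N : ℝ) ^ 2 := by
    simp only [mul_pow, ind_sq]
    rw [sum_prod_mul (ind Finset.univ) (ind Finset.univ), sum_ind, Finset.card_univ,
      Fintype.card_fin, sq]
  have h := measureReal_linear_ge_le hX hind _ hc (t := δ * N * √N) (by positivity)
  refine le_trans (le_of_eq ?_) (h.trans (Real.exp_le_exp.2 (le_of_eq ?_)))
  · congr 1
    ext ω
    rw [Set.mem_ofPred_eq, Set.mem_ofPred_eq, quad_eq_sum]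
  · rw [mul_pow, hs]
    field_simp

/-- The energy of `S`, centred by its share of the total energy, is rarely large. -/
lemma measureReal_centred_ge_le (hX : ∀ p, HasSubgaussianMGF (X p) 1 P) (hind : iIndepFun X P)
    {m ρ : ℝ} (hm0 : 0 ≤ m) (hm : ∀ b ∈ Set.Ioo (0 : ℝ) 1, criticalSq b ≤ m ^ 2)
    (hρ0 : 0 ≤ ρ) (hρ1 : ρ ≤ 1)
    (S : Finset (Fin N)) (hk0 : 0 < S.card) (hkN : S.card < N) :
    P.real {ω | ρ * m * N * √N ≤ quad (fun i j => X (i, j) ω) (ind S) (ind S) -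
        ((S.card : ℝ) / N) ^ 2 *
          quad (fun i j => X (i, j) ω) (ind Finset.univ) (ind Finset.univ)} ≤
      ((S.card : ℝ) / N) ^ S.card * (1 - (S.card : ℝ) / N) ^ (N - S.card) *
        Real.exp (N * (1 - ρ ^ 2) * Real.log 2) := by
  set α : ℝ := (S.card : ℝ) / N with hα
  have hN' : (0 : ℝ) < N := by exact_mod_cast hk0.trans hkN
  have hs : √(N : ℝ) ^ 2 = N := Real.sq_sqrt hN'.le
  have hk : (S.card : ℝ) = α * N := by rw [hα]; field_simp
  have hαI : α ∈ Set.Ioo (0 : ℝ) 1 := by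
    refine ⟨div_pos (by exact_mod_cast hk0) hN', ?_⟩
    rw [hα, div_lt_one hN']; exact_mod_cast hkN
  have hw := weight_pos hαI
  have hc : ∑ p : Fin N × Fin N, (ind S p.1 * ind S p.2 - α ^ 2) ^ 2 ≤
      N ^ 2 * (α ^ 2 * (1 - α ^ 2)) := by
    have e : ∀ p : Fin N × Fin N, (ind S p.1 * ind S p.2 - α ^ 2) ^ 2 =
        (1 - 2 * α ^ 2) * (ind S p.1 * ind S p.2) + α ^ 4 := by
      intro p
      rw [sub_sq, mul_pow, ind_sq, ind_sq]; ring
    simp only [e, Finset.sum_add_distrib, ← Finset.mul_sum]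
    rw [sum_prod_mul (ind S) (ind S), sum_ind, hk]
    simp
    apply le_of_eq; ring
  have h := measureReal_linear_ge_le hX hind (t := ρ * m * N * √N) _ hc (by positivity)
  refine le_trans (measureReal_mono ?_) (h.trans ?_)
  · intro ω hω
    simp only [Set.mem_ofPred_eq, quad_eq_sum] at hω ⊢
    refine hω.trans (le_of_eq ?_)
    rw [Finset.mul_sum, ← Finset.sum_sub_distrib]
    refine Finset.sum_congr rfl fun p _ => ?_
    have h1 : ∀ i : Fin N, ind Finset.univ i = 1 := by simp [ind]
    rw [h1, h1]; ring
  · rw [← exp_neg_binEntropy hk0 hkN, ← Real.exp_add, ← hα]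
    apply Real.exp_le_exp.2
    have h1 : -(ρ * m * N * √N) ^ 2 / (2 * (N ^ 2 * (α ^ 2 * (1 - α ^ 2)))) =
        -(N * ρ ^ 2 * (m ^ 2 / (2 * α ^ 2 * (1 - α ^ 2)))) := by
      have hα0 : α ≠ 0 := hαI.1.ne'
      have hα1 : 1 - α ^ 2 ≠ 0 := by
        intro h0; rw [h0] at hw; simp at hw
      rw [mul_pow, hs]
      field_simp
    rw [h1]
    -- Nonpositivity of `rate m` at α: the Gaussian exponent at level m beats the entropy. Lowering
    -- the level by the factor ρ loses only (1 - ρ²) times the entropy.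
    have h2 : Real.binEntropy α ≤ m ^ 2 / (2 * α ^ 2 * (1 - α ^ 2)) := by
      rw [le_div_iff₀ hw]
      have := hm α hαI
      unfold criticalSq at this; linarith
    have h3 : N * ρ ^ 2 * Real.binEntropy α ≤
        N * ρ ^ 2 * (m ^ 2 / (2 * α ^ 2 * (1 - α ^ 2))) := by gcongr
    have h4 : N * (1 - ρ ^ 2) * Real.binEntropy α ≤ N * (1 - ρ ^ 2) * Real.log 2 := by
      have : 0 ≤ 1 - ρ ^ 2 := by nlinarith
      gcongr
      exact Real.binEntropy_le_log_two
    nlinarith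

lemma exp_le_choose {δ : ℝ} (hδ : δ ≤ Real.exp (-50)) {n : ℕ}
    (hn : (n : ℝ) ≤ δ * N) (hn' : δ * N - 1 ≤ n) :
    Real.exp (48 * (δ * N) - 48) ≤ (((N + 1) / 2).choose n : ℝ) := by
  have ha : (N : ℝ) / 2 ≤ ((N + 1) / 2 : ℕ) := by
    rw [div_le_iff₀ (by norm_num)]
    have : N ≤ (N + 1) / 2 * 2 := by omega
    exact_mod_cast this
  have hnN : (n : ℝ) ≤ Real.exp (-50) * N := hn.trans (by gcongr)
  have h2 : Real.exp (-2) ≤ 1 / 4 := by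
    rw [Real.exp_neg, ← one_div]
    apply one_div_le_one_div_of_le (by norm_num)
    have h1 : (2 : ℝ) ≤ Real.exp 1 := by linarith [Real.add_one_le_exp (1 : ℝ)]
    calc (4 : ℝ) = 2 ^ 2 := by norm_num
      _ ≤ Real.exp 1 ^ 2 := by gcongr
      _ = Real.exp 2 := by rw [← Real.exp_nat_mul]; norm_num
  -- With n ≤ e^{-50}N there are still at least e^{48} n candidates left after n choices, so each
  -- flip contributes a factor e^{48}.
  have hrn : Real.exp 48 * n ≤ N / 4 := by
    calc Real.exp 48 * n ≤ Real.exp 48 * (Real.exp (-50) * N) := by gcongr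
      _ = Real.exp (-2) * N := by rw [← mul_assoc, ← Real.exp_add]; norm_num
      _ ≤ 1 / 4 * N := by gcongr
      _ = N / 4 := by ring
  have hn4 : (n : ℝ) ≤ N / 4 := by
    refine le_trans ?_ hrn
    exact le_mul_of_one_le_left (Nat.cast_nonneg _) (Real.one_le_exp (by norm_num))
  have hNn : (0 : ℝ) ≤ N := Nat.cast_nonneg _
  refine le_trans ?_ (pow_le_choose_of_mul_le (Real.exp_nonneg 48) ?_ ?_)
  · rw [← Real.exp_nat_mul]
    apply Real.exp_le_exp.2; linarith
  · have : (n : ℝ) ≤ ((N + 1) / 2 : ℕ) := by linarith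
    exact (Nat.cast_le.1 this).trans (Nat.le_succ _)
  · linarith

/-- The probability that some configuration reaches a level `m` that is critical for the first
moment method. -/
lemma measureReal_exists_quad_ge_le (hX : ∀ p, HasSubgaussianMGF (X p) 1 P) (hind : iIndepFun X P)
    {m δ : ℝ} (hm2 : 1 / 2 ≤ m) (hm : ∀ b ∈ Set.Ioo (0 : ℝ) 1, criticalSq b ≤ m ^ 2)
    (hδ0 : 0 < δ) (hδ : δ ≤ Real.exp (-50)) (hδN : 1 ≤ δ * N) :
    P.real {ω | ∃ S : Finset (Fin N),
        m * N * √N ≤ quad (fun i j => X (i, j) ω) (ind S) (ind S)} ≤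
      2 * Real.exp (-N) + Real.exp (-(δ ^ 2 * N / 2)) +
        (N + 1) * Real.exp (48 - 8 * (δ * N)) := by
  have hN : 0 < N := by
    rcases Nat.eq_zero_or_pos N with h | h
    · subst h; norm_num at hδN
    · exact h
  have hN' : (0 : ℝ) < N := by exact_mod_cast hN
  have hs0 : 0 < √(N : ℝ) := Real.sqrt_pos.2 hN'
  have hδs : δ ≤ 1 / 51 := by
    refine hδ.trans ?_
    rw [Real.exp_neg, ← one_div]
    exact one_div_le_one_div_of_le (by norm_num) (by linarith [Real.add_one_le_exp (50 : ℝ)])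
  set n : ℕ := ⌊δ * N⌋₊ with hn_def
  have hn_le : (n : ℝ) ≤ δ * N := Nat.floor_le (by positivity)
  have hn_ge : δ * N - 1 ≤ n := by linarith [Nat.lt_floor_add_one (δ * N)]
  have hn0 : 0 < n := Nat.floor_pos.2 hδN
  set E1 : Set Ω := {ω | ∃ S B : Finset (Fin N),
    quad (fun i j => X (i, j) ω) (flip S B) (ind S) +
      quad (fun i j => X (i, j) ω) (ind S) (flip S B) ≤ -(5 * N * √N)} with hE1
  set E2 : Set Ω := {ω | ∃ S D : Finset (Fin N), D.card = n ∧
      quad (fun i j => X (i, j) ω) (flip S D) (flip S D) ≤ -(3 * n * √N)} with hE2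
  set E3 : Set Ω := {ω | δ * N * √N ≤
    quad (fun i j => X (i, j) ω) (ind Finset.univ) (ind Finset.univ)} with hE3
  set A : Set Ω := {ω | ∃ S : Finset (Fin N),
        m * N * √N ≤ quad (fun i j => X (i, j) ω) (ind S) (ind S)} with hA
  set A' : Set Ω := A \ (E1 ∪ E2 ∪ E3) with hA'
  have hP1 := measureReal_flip_linear_le hN hX hind
  have hP2 := measureReal_flip_quadratic_le hN hX hind hn0
  have hP3 := measureReal_total_ge_le hN hX hind hδ0.le
  let B : Finset (Fin N) → Set Ω := fun S => {ω |
    m * N * √N - 13 * n * √N ≤ quad (fun i j => X (i, j) ω) (ind S) (ind S) ∧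
    quad (fun i j => X (i, j) ω) (ind Finset.univ) (ind Finset.univ) < δ * N * √N}
  have hmarkov := mul_measureReal_le_sum (P := P) A' B (((N + 1) / 2).choose n) (by
    rintro ω ⟨⟨S, hS⟩, hbad⟩
    simp only [Set.mem_union, not_or] at hbad
    obtain ⟨⟨h1, h2⟩, h3⟩ := hbad
    simp only [hE1, hE2, hE3, Set.mem_ofPred_eq, not_exists, not_and, not_le] at h1 h2 h3
    obtain ⟨F, hF, hF'⟩ := exists_many_flips (fun i j => X (i, j) ω) hs0.le
      (fun S B _ => h1 S B) h2 hS
    exact ⟨F, hF, fun S' hS' => ⟨hF' S' hS', h3⟩⟩)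
  -- Of the 14δ, 13δ is the cost of the flips and δ bounds the subtracted share of the total energy.
  set ρ : ℝ := 1 - 14 * δ / m with hρ
  have hm0 : 0 < m := by linarith
  have hdm : 14 * δ / m ≤ 28 * δ := by
    rw [div_le_iff₀ hm0]; nlinarith
  have hdm0 : 0 ≤ 14 * δ / m := by positivity
  have hρm : ρ * m = m - 14 * δ := by rw [hρ]; field_simp
  have hB : ∀ S, P.real (B S) ≤ ((S.card : ℝ) / N) ^ S.card *
      (1 - (S.card : ℝ) / N) ^ (N - S.card) * Real.exp (40 * (δ * N)) := by
    intro S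
    have hw0 : 0 ≤ ((S.card : ℝ) / N) ^ S.card * (1 - (S.card : ℝ) / N) ^ (N - S.card) := by
      have : (S.card : ℝ) / N ≤ 1 := by
        refine div_le_one_of_le₀ ?_ hN'.le
        have := Finset.card_le_univ S
        rw [Fintype.card_fin] at this
        exact_mod_cast this
      exact mul_nonneg (by positivity) (pow_nonneg (by linarith) _)
    -- The lowered level still exceeds the bound on the total energy, which rules out the empty and
    -- the full set, where the centred estimate does not apply.
    have hlev : δ * N * √N < m * N * √N - 13 * n * √N := by
      have : δ * N < m * N - 13 * n := by nlinarith
      nlinarith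
    have hempty : B S = ∅ → P.real (B S) ≤ ((S.card : ℝ) / N) ^ S.card *
        (1 - (S.card : ℝ) / N) ^ (N - S.card) * Real.exp (40 * (δ * N)) := by
      intro h
      rw [h, measureReal_empty]
      exact mul_nonneg hw0 (Real.exp_nonneg _)
    rcases Nat.eq_zero_or_pos S.card with hk0 | hk0
    · apply hempty
      rw [Finset.card_eq_zero] at hk0
      ext ω
      simp only [B, Set.mem_ofPred_eq, Set.mem_empty_iff_false, iff_false, not_and, hk0]
      intro h
      have : quad (fun i j => X (i, j) ω) (ind ∅) (ind ∅) = 0 := by simp [quad, ind]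
      rw [this] at h
      have : 0 < δ * N * √N := by positivity
      linarith
    rcases lt_or_ge S.card N with hkN | hkN
    swap
    · apply hempty
      have hS : S = Finset.univ := by
        rw [← Finset.card_eq_iff_eq_univ, Fintype.card_fin]
        refine le_antisymm ?_ hkN
        have := Finset.card_le_univ S
        rwa [Fintype.card_fin] at this
      ext ω
      simp only [B, Set.mem_ofPred_eq, Set.mem_empty_iff_false, iff_false, not_and, hS]
      intro h
      linarith
    refine le_trans (measureReal_mono ?_) ((measureReal_centred_ge_le hX hind hm0.le hm
      (ρ := ρ) (by linarith) (by linarith) S hk0 hkN).trans ?_)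
    · rintro ω ⟨h1, h2⟩
      rw [Set.mem_ofPred_eq, hρm]
      have hα0 : 0 ≤ ((S.card : ℝ) / N) ^ 2 := by positivity
      have hα1 : ((S.card : ℝ) / N) ^ 2 ≤ 1 := by
        refine pow_le_one₀ (by positivity) (div_le_one_of_le₀ ?_ hN'.le)
        exact_mod_cast hkN.le
      have hδs0 : 0 ≤ δ * N * √N := by positivity
      have h3 : ((S.card : ℝ) / N) ^ 2 *
          quad (fun i j => X (i, j) ω) (ind Finset.univ) (ind Finset.univ) ≤ δ * N * √N :=
        (mul_le_mul_of_nonneg_left h2.le hα0).trans (mul_le_of_le_one_left hδs0 hα1)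
      have h4 : 13 * n * √N ≤ 13 * (δ * N) * √N := by gcongr
      linarith
    · refine mul_le_mul_of_nonneg_left (Real.exp_le_exp.2 ?_) hw0
      have hl : Real.log 2 ≤ 0.7 := by linarith [Real.log_two_lt_d9]
      have hl0 : 0 ≤ Real.log 2 := Real.log_nonneg (by norm_num)
      -- 1 - ρ² ≤ 28δ/m with m ≥ 1/2; then 56 · 0.7 = 39.2 explains the constant 40.
      have h1 : 1 - ρ ^ 2 ≤ 56 * δ := by rw [hρ]; nlinarith
      calc N * (1 - ρ ^ 2) * Real.log 2 ≤ N * (56 * δ) * 0.7 := by gcongr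
        _ ≤ 40 * (δ * N) := by nlinarith [mul_pos hδ0 hN']
  have hsum : ∑ S, P.real (B S) ≤ (N + 1) * Real.exp (40 * (δ * N)) := by
    refine (Finset.sum_le_sum fun S _ => hB S).trans ?_
    rw [← Finset.sum_mul]
    exact mul_le_mul_of_nonneg_right (sum_binomial_weight_le N) (Real.exp_nonneg _)
  have hA'le : P.real A' ≤ (N + 1) * Real.exp (48 - 8 * (δ * N)) := by
    have h1 := (mul_le_mul_of_nonneg_right (exp_le_choose hδ hn_le hn_ge)
      (measureReal_nonneg (μ := P) (s := A'))).trans (hmarkov.trans hsum)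
    rw [mul_comm, ← le_div_iff₀ (Real.exp_pos _), mul_div_assoc, ← Real.exp_sub] at h1
    refine h1.trans (le_of_eq ?_)
    congr 2; ring
  have hcover : A ⊆ A' ∪ (E1 ∪ E2 ∪ E3) := by
    intro ω hω
    by_cases h : ω ∈ E1 ∪ E2 ∪ E3
    · exact Or.inr h
    · exact Or.inl ⟨hω, h⟩
  have hu1 := measureReal_mono (μ := P) hcover
  have hu2 := measureReal_union_le (μ := P) A' (E1 ∪ E2 ∪ E3)
  have hu3 := measureReal_union_le (μ := P) (E1 ∪ E2) E3
  have hu4 := measureReal_union_le (μ := P) E1 E2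
  linarith

end Probability

/-! ### Constants and the final assembly -/

lemma exists_exponential_bound {δ : ℝ} (hδ0 : 0 < δ) (hδ1 : δ ≤ 1) :
    ∃ C : ℝ, 0 < C ∧ ∃ N₀ : ℕ, ∀ N : ℕ, N₀ ≤ N → 1 ≤ δ * N ∧
      2 * Real.exp (-N) + Real.exp (-(δ ^ 2 * N / 2)) +
        (N + 1) * Real.exp (48 - 8 * (δ * N)) ≤ Real.exp (-C * N) := by
  -- The guaranteed common decay rate is δ²/2 = 2C, from the total energy; half of it is spent on
  -- absorbing the prefactor K.
  set C : ℝ := δ ^ 2 / 4 with hC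
  have hC0 : 0 < C := by positivity
  set K : ℝ := 3 + Real.exp 48 / δ with hK
  have hK0 : 0 < K := by positivity
  refine ⟨C, hC0, ⌈max (1 / δ) (Real.log K / C)⌉₊, fun N hN => ?_⟩
  have hN1 := Nat.ceil_le.1 hN
  have hNd : 1 / δ ≤ N := (le_max_left _ _).trans hN1
  have hNC : Real.log K / C ≤ N := (le_max_right _ _).trans hN1
  rw [div_le_iff₀ hδ0] at hNd
  rw [div_le_iff₀ hC0] at hNC
  refine ⟨by linarith, ?_⟩
  have hNn : (0 : ℝ) ≤ N := Nat.cast_nonneg _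
  have hδ2 : δ ^ 2 ≤ δ := by nlinarith
  have h1 : Real.exp (-N) ≤ Real.exp (-(2 * C * N)) := by
    apply Real.exp_le_exp.2; rw [hC]; nlinarith
  have h2 : Real.exp (-(δ ^ 2 * N / 2)) = Real.exp (-(2 * C * N)) := by
    rw [hC]; ring_nf
  have h3 : (N + 1) * Real.exp (48 - 8 * (δ * N)) ≤ Real.exp 48 / δ * Real.exp (-(2 * C * N)) := by
    have ha : (N : ℝ) + 1 ≤ Real.exp (δ * N) / δ := by
      rw [le_div_iff₀ hδ0]
      nlinarith [Real.add_one_le_exp (δ * N)]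
    calc (N + 1) * Real.exp (48 - 8 * (δ * N))
        ≤ Real.exp (δ * N) / δ * Real.exp (48 - 8 * (δ * N)) := by gcongr
      _ = Real.exp 48 / δ * Real.exp (-(7 * (δ * N))) := by
        rw [div_mul_eq_mul_div, div_mul_eq_mul_div, ← Real.exp_add, ← Real.exp_add]; ring_nf
      _ ≤ _ := by
        refine mul_le_mul_of_nonneg_left (Real.exp_le_exp.2 ?_) (by positivity)
        rw [hC]; nlinarith
  calc _ ≤ K * Real.exp (-(2 * C * N)) := by rw [hK]; linarith
    _ ≤ Real.exp (C * N) * Real.exp (-(2 * C * N)) := by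
      gcongr
      rw [← Real.exp_log hK0]
      apply Real.exp_le_exp.2; linarith
    _ = Real.exp (-C * N) := by rw [← Real.exp_add]; ring_nf

lemma exists_quad_ge_of_energy {N : ℕ} (hN : 0 < N) {J : Fin N → Fin N → ℝ} {t : ℝ}
    {η : Config N} (h : t ≤ energy J η) :
    ∃ S : Finset (Fin N), t * √N ≤ quad J (ind S) (ind S) := by
  refine ⟨Finset.univ.filter fun i => η i = 1, ?_⟩
  have hs0 : 0 < √(N : ℝ) := Real.sqrt_pos.2 (by exact_mod_cast hN)
  have he : ∀ i, ind (Finset.univ.filter fun i => η i = 1) i = ((η i : ℕ) : ℝ) := by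
    intro i
    have : η i = 0 ∨ η i = 1 := by generalize η i = x; revert x; decide
    rcases this with h | h <;> simp [ind, h]
  have hq : quad J (ind (Finset.univ.filter fun i => η i = 1))
      (ind (Finset.univ.filter fun i => η i = 1)) = √N * energy J η := by
    simp only [quad, he, energy]
    rw [← mul_assoc, mul_one_div_cancel hs0.ne', one_mul]
  rw [hq, mul_comm]
  gcongr

lemma energy_neg {N : ℕ} (J : Fin N → Fin N → ℝ) (η : Config N) :
    energy (fun i j => -J i j) η = -energy J η := by
  simp [energy, Finset.sum_neg_distrib]

end Qubo

theorem corollary1 :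
    ∃ mStar αStar : ℝ,
      IsGLB Qubo.zeroFree mStar ∧
      αStar ∈ Set.Ioo (0 : ℝ) 1 ∧
      Qubo.rate mStar αStar = 0 ∧
      (∀ α ∈ Set.Ioo (0 : ℝ) 1, Qubo.rate mStar α = 0 → α = αStar) ∧
      |mStar - 0.562| ≤ 0.0005 ∧
      |αStar - 0.644| ≤ 0.0005 ∧
      ∀ (μ : Measure ℝ) [IsProbabilityMeasure μ],
        ∫ x, x ∂μ = 0 →
        variance (fun x : ℝ => x) μ = 1 →
        HasSubgaussianMGF (fun x : ℝ => x) 1 μ →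
        ∃ C : ℝ, 0 < C ∧ ∃ N₀ : ℕ, ∀ N : ℕ, N₀ ≤ N →
          ∀ (Ω : Type*) [MeasurableSpace Ω] (P : Measure Ω) [IsProbabilityMeasure P]
            (J : Fin N → Fin N → Ω → ℝ),
            (∀ i j, HasLaw (J i j) μ P) →
            iIndepFun (fun p : Fin N × Fin N => J p.1 p.2) P →
            P.real {ω | 0 < Qubo.nuMinus (fun i j => J i j ω) mStar} ≤ Real.exp (-C * N) ∧
            P.real {ω | 0 < Qubo.nuPlus (fun i j => J i j ω) mStar} ≤ Real.exp (-C * N) := by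
  obtain ⟨m, a, hglb, ha, hz, huniq, hm1, ha1, hmax⟩ := Qubo.exists_critical
  refine ⟨m, a, hglb, ha, hz, huniq, hm1, ha1, fun μ _ _ _ hsub => ?_⟩
  have hm2 : 1 / 2 ≤ m := by have := (abs_le.1 hm1).1; norm_num at *; linarith
  obtain ⟨C, hC, N₀, hbound⟩ := Qubo.exists_exponential_bound (Real.exp_pos (-50))
    (Real.exp_le_one_iff.2 (by norm_num))
  refine ⟨C, hC, N₀, fun N hN Ω _ P _ J hlaw hindep => ?_⟩
  obtain ⟨hδN, hb⟩ := hbound N hN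
  have hN0 : 0 < N := by
    rcases Nat.eq_zero_or_pos N with h | h
    · subst h; norm_num at hδN
    · exact h
  have hX : ∀ p : Fin N × Fin N, HasSubgaussianMGF (J p.1 p.2) 1 P := fun p => by
    have h := hlaw p.1 p.2
    exact HasSubgaussianMGF.of_map (X := fun x : ℝ => x) (Y := J p.1 p.2) h.aemeasurable
      (by rw [h.map_eq]; exact hsub)
  constructor
  -- Only subgaussianity and independence enter the bound, and both pass to -J, so no symmetry of
  -- the law is needed.
  · have hneg := Qubo.measureReal_exists_quad_ge_le (fun p => (hX p).neg)
      (hindep.comp (fun _ x => -x) fun _ => measurable_neg) hm2 hmax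
      (Real.exp_pos (-50)) le_rfl hδN
    refine le_trans (measureReal_mono ?_) (hneg.trans hb)
    intro ω hω
    obtain ⟨η, hη⟩ := Finset.card_pos.1 hω
    have hη' := (Finset.mem_filter.1 hη).2
    refine Qubo.exists_quad_ge_of_energy hN0 (η := η) ?_
    change m * N ≤ Qubo.energy (fun i j => -J i j ω) η
    rw [Qubo.energy_neg]
    linarith
  · have hpos := Qubo.measureReal_exists_quad_ge_le hX hindep hm2 hmax
      (Real.exp_pos (-50)) le_rfl hδN
    refine le_trans (measureReal_mono ?_) (hpos.trans hb)
    intro ω hω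
    obtain ⟨η, hη⟩ := Finset.card_pos.1 hω
    exact Qubo.exists_quad_ge_of_energy hN0 (Finset.mem_filter.1 hη).2
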